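/- **Setting.** Let $O\subseteq\mathbb R^n$ be open (a coordinate chart). A deformation on $O$ is given by smooth functions $H^m(x,\tilde t)$, defined for $x\in O$, $x+\tilde t\in O$, with $H^m(x,0)=0$, for which there are smooth functions $K^\mu(x,t)$, defined on the values $t=H(x,\tilde t)$, with $K(x,H(x,\tilde t))=\tilde t$. Put $h(x)^\mu_m=\partial_{t^m}K^\mu(x,t)|_{t=0}$, let $H^\mu(x,\tilde t)=h(x)^\mu_m H^m(x,\tilde t)$ be the deformation functions in the coordinate basis, and let $\Gamma(x)^\mu_{\sigma\nu}=\partial^2H^\mu(x,\tilde t)/\partial\tilde t^\sigma\partial\tilde t^\nu|_{\tilde t=0}$. A curve $x(s)$, $s\in[0,T]$, $T>0$, in $O$ with velocity $\tau=\dot x$ satisfies the canonicity condition if $$\tau^\mu(s)=\frac{\partial H^\mu}{\partial\tilde t^\nu}\bigl(x(s),x(s')-x(s)\bigr)\,\tau^\nu(s')\qquad\text{for all } s,s'\in[0,T].\tag{14}$$ The deformation is canonical if any two points of $O$ are joined by at least one curve in $O$ satisfying (14). A geodesic of $\Gamma$ in affine parameterization is a curve in $O$ with $\dot x=\tau$,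 $\dot\tau^\mu+\Gamma(x)^\mu_{\sigma\nu}\tau^\sigma\tau^\nu=0$. **Proposition 1 (uniqueness of canonical deformations).** (a) $\Gamma$ is smooth and symmetric in its lower indices, i.e. it gives a torsion-free affine connection on $O$. Every curve satisfying (14) is a geodesic of $\Gamma$ in affine parameterization. Between two given points $x,x'\in O$ there is, up to the affine change of parameter that rescales $[0,T]$, at most one curve in $O$ satisfying (14); if the deformation is canonical, this curve is also the only geodesic of $\Gamma$ contained in $O$ that joins $x$ to $x'$, up to the same change of parameter. (b) If two canonical deformations on $O$ have the same connection coefficients $\Gamma$ on $O$, then their deformation functions in the coordinate basis $H^\mu(x,\tilde t)$ coincide for all $x\in O$, $x+\tilde t\in O$. For a canonical deformation, the derivatives of the deformation functions along geodesics are first integrals of the geodesic equations on the geodesics through the base point: for every geodesic $x(s)$, $s\in[0,T]$, in $O$ and all $s_0,s\in[0,T]$, $$\frac{d}{ds}H^\mu\bigl(x(s_0),x(s)-x(s_0)\bigr)=\frac{\partial H^\mu}{\partial\tilde t^\nu}\bigl(x(s_0),x(s)-x(s_0)\bigr)\,\tau^\nu(s)=\tau^\mu(s_0),$$ which does not depend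 on $s$; and these $n$ first integrals are independent, the matrix $\partial_{\tilde\nu}H^\mu(x,x'-x)$ being invertible for all $x,x'\in O$. -/

import Mathlib

open Set
open scoped ContDiff

/-- A deformation over the coordinate chart `O ⊆ ℝⁿ`. The deformation functions `H x s = H^m(x, s)`
take as arguments a point `x ∈ O` and the value `s` at `x` of a (local) shift `s̃(x)`, so that
`x + s ∈ O`; the functions `K x t = K^μ(x, t)` specify the reverse transition, and need only be
defined for values `t` of parameters of the deformed group. -/
structure Deformation {n : ℕ} (O : Set (Fin n → ℝ)) where
  /-- the deformation functions `H^m(x, s)` -/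
  H : (Fin n → ℝ) → (Fin n → ℝ) → (Fin n → ℝ)
  /-- the reverse functions `K^μ(x, t)` -/
  K : (Fin n → ℝ) → (Fin n → ℝ) → (Fin n → ℝ)
  smooth_H : ContDiffOn ℝ ∞ (fun p : (Fin n → ℝ) × (Fin n → ℝ) => H p.1 p.2)
    {p | p.1 ∈ O ∧ p.1 + p.2 ∈ O}
  smooth_K : ContDiffOn ℝ ∞ (fun p : (Fin n → ℝ) × (Fin n → ℝ) => K p.1 p.2)
    {p | p.1 ∈ O ∧ ∃ s, p.1 + s ∈ O ∧ H p.1 s = p.2}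
  H_zero : ∀ x ∈ O, H x 0 = 0
  K_H : ∀ x ∈ O, ∀ s, x + s ∈ O → K x (H x s) = s

namespace Deformation

variable {n : ℕ} {O : Set (Fin n → ℝ)}

/-- The affine vielbein `h(x)^μ_m = ∂_m K^μ(x, t)` at `t = 0`. -/
noncomputable def vielbein (D : Deformation O) (x : Fin n → ℝ) :
    (Fin n → ℝ) →L[ℝ] (Fin n → ℝ) :=
  fderiv ℝ (D.K x) 0

/-- The deformation functions in the coordinate basis, `H^μ(x, s) = h(x)^μ_m H^m(x, s)`. -/
noncomputable def coordH (D : Deformation O) (x s : Fin n → ℝ) : Fin n → ℝ :=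
  D.vielbein x (D.H x s)

/-- The matrix `∂_{s^ν} H^μ(x, s)` at `s = x' - x`, which transports vectors from `x'` to `x`. -/
noncomputable def transport (D : Deformation O) (x x' : Fin n → ℝ) :
    (Fin n → ℝ) →L[ℝ] (Fin n → ℝ) :=
  fderiv ℝ (D.coordH x) (x' - x)

/-- The connection coefficients `Γ(x)^μ_{σν} = ∂²H^μ(x, s) / ∂s^σ ∂s^ν` at `s = 0`, as the bilinear
map `(u, v) ↦ Γ(x)^μ_{σν} u^σ v^ν`. -/
noncomputable def Gam (D : Deformation O) (x : Fin n → ℝ) :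
    (Fin n → ℝ) →L[ℝ] (Fin n → ℝ) →L[ℝ] (Fin n → ℝ) :=
  fderiv ℝ (fderiv ℝ (D.coordH x)) 0

end Deformation

/-- `y` is a differentiable curve in `O`, parameterized by `[0, T]` with `T > 0`, with `y 0 = x` and
`y T = x'`, and `τ` is its velocity (one-sided at the end points). -/
structure IsCurve {n : ℕ} (O : Set (Fin n → ℝ)) (x x' : Fin n → ℝ) (T : ℝ)
    (y τ : ℝ → Fin n → ℝ) : Prop where
  pos : 0 < T
  mem : ∀ s ∈ Icc 0 T, y s ∈ O
  source : y 0 = x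
  target : y T = x'
  velocity : ∀ s ∈ Icc 0 T, HasDerivWithinAt y (τ s) (Icc 0 T) s

/-- `Γ` is a field of coefficients of a torsion-free affine connection on `O`: it is smooth and
symmetric in the lower indices. -/
structure IsTorsionFreeConnection {n : ℕ} (O : Set (Fin n → ℝ))
    (Γ : (Fin n → ℝ) → (Fin n → ℝ) →L[ℝ] (Fin n → ℝ) →L[ℝ] (Fin n → ℝ)) : Prop where
  smooth : ContDiffOn ℝ ∞ Γ O
  symm : ∀ x ∈ O, ∀ u v, Γ x u v = Γ x v u

/-- `y`, with velocity `τ`, is a geodesic in affine parameterization of the connection `Γ` in `O`,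
joining `x` to `x'`:  `τ'^μ + Γ(y)^μ_{σν} τ^σ τ^ν = 0`. -/
structure IsGeodesic {n : ℕ} (O : Set (Fin n → ℝ))
    (Γ : (Fin n → ℝ) → (Fin n → ℝ) →L[ℝ] (Fin n → ℝ) →L[ℝ] (Fin n → ℝ))
    (x x' : Fin n → ℝ) (T : ℝ) (y τ : ℝ → Fin n → ℝ) : Prop extends IsCurve O x x' T y τ where
  geodesic : ∀ s ∈ Icc 0 T, HasDerivWithinAt τ (-(Γ (y s) (τ s) (τ s))) (Icc 0 T) s

namespace Deformation

variable {n : ℕ} {O : Set (Fin n → ℝ)}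

/-- The curve `y` joins `x` to `x'` in `O`, and the condition of canonicity holds along it:
`τ^μ(s) = ∂_ν H^μ(y(s), y(s') - y(s)) τ^ν(s')` for all `s, s' ∈ [0, T]`. -/
structure CanonicalAlong (D : Deformation O) (x x' : Fin n → ℝ) (T : ℝ)
    (y τ : ℝ → Fin n → ℝ) : Prop extends IsCurve O x x' T y τ where
  canonical : ∀ s ∈ Icc 0 T, ∀ s' ∈ Icc 0 T, τ s = D.transport (y s) (y s') (τ s')

/-- A deformation is canonical if any two points of `O` are joined by at least one curve along which
the condition of canonicity holds. -/
def IsCanonical (D : Deformation O) : Prop :=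
  ∀ x ∈ O, ∀ x' ∈ O, ∃ T y τ, D.CanonicalAlong x x' T y τ

end Deformation

/-! The map `z ↦ coordH x (z - x)` plays the role of normal coordinates at `x`. It is injective,
since `K` inverts `H` and the vielbein is invertible. Canonicity with one point held at `x` says
that its derivative along the curve is the constant `τ 0`, so it straightens the curve into `s • τ
0`; this gives uniqueness. Differentiating canonicity in the second point on the diagonal, where
`transport` is the identity and its derivative is `Gam`, gives the geodesic equation.

The hard point is the converse (`IsCanonical.transport_geodesic_source`): if `D` is canonical, every
geodesic in `O` is canonical, however far it runs from `x`. Along a geodesic the transported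
velocity `p` satisfies `p' = B(τ, τ)`, where `B` is `defect`. Canonical curves from `x` reach every
point, so `B` vanishes on radial vectors (`defect_radial`). The failure of the geodesic to be radial
is measured by `w = u - s • p`, with `u` the normal coordinates of the moving point. Radial
vanishing yields `‖w'‖ ≤ C ‖w‖`, and Gronwall forces `w = 0`; hence `p` is constant. Part (b)
follows because a canonical curve of one deformation is then canonical for the other, and `coordH`
at the end point is `T • τ 0` for both. -/

/-- A bijective endomorphism of `ℝⁿ` as a continuous linear equivalence. -/
noncomputable def bijectiveEquiv {n : ℕ} {L : (Fin n → ℝ) →L[ℝ] (Fin n → ℝ)}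
    (hL : Function.Bijective L) : (Fin n → ℝ) ≃L[ℝ] (Fin n → ℝ) :=
  ContinuousLinearEquiv.ofBijective L (LinearMap.ker_eq_bot.2 hL.1) (LinearMap.range_eq_top.2 hL.2)

theorem coe_bijectiveEquiv {n : ℕ} {L : (Fin n → ℝ) →L[ℝ] (Fin n → ℝ)}
    (hL : Function.Bijective L) :
    (bijectiveEquiv hL : (Fin n → ℝ) →L[ℝ] (Fin n → ℝ)) = L := rfl

theorem contDiffAt_inverse_of_bijective {n : ℕ} {L : (Fin n → ℝ) →L[ℝ] (Fin n → ℝ)}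
    (hL : Function.Bijective L) : ContDiffAt ℝ ∞ ContinuousLinearMap.inverse L :=
  contDiffAt_map_inverse (𝕜 := ℝ) (n := ∞) (bijectiveEquiv hL)

theorem apply_inverse_of_bijective {n : ℕ} {L : (Fin n → ℝ) →L[ℝ] (Fin n → ℝ)}
    (hL : Function.Bijective L) (v : Fin n → ℝ) : L (L.inverse v) = v := by
  rw [← coe_bijectiveEquiv hL, ContinuousLinearMap.inverse_equiv]
  exact (bijectiveEquiv hL).apply_symm_apply v

/-! ### Smoothness and invertibility of the vielbein and the transport. -/

namespace Deformation

variable {n : ℕ} {O : Set (Fin n → ℝ)}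

theorem contDiffAt_H (D : Deformation O) (hO : IsOpen O) {x s : Fin n → ℝ} (hx : x ∈ O)
    (hs : x + s ∈ O) :
    ContDiffAt ℝ ∞ (fun p : (Fin n → ℝ) × (Fin n → ℝ) => D.H p.1 p.2) (x, s) := by
  have hopen : IsOpen {p : (Fin n → ℝ) × (Fin n → ℝ) | p.1 ∈ O ∧ p.1 + p.2 ∈ O} :=
    (hO.preimage continuous_fst).inter (hO.preimage (continuous_fst.add continuous_snd))
  exact D.smooth_H.contDiffAt (hopen.mem_nhds ⟨hx, hs⟩)

theorem contDiffAt_H_right (D : Deformation O) (hO : IsOpen O) {x s : Fin n → ℝ} (hx : x ∈ O)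
    (hs : x + s ∈ O) : ContDiffAt ℝ ∞ (D.H x) s :=
  (D.contDiffAt_H hO hx hs).comp s (contDiffAt_const.prodMk contDiffAt_id)

theorem bijective_fderiv_H (D : Deformation O) (hO : IsOpen O) {x s : Fin n → ℝ} (hx : x ∈ O)
    (hs : x + s ∈ O) : Function.Bijective (fderiv ℝ (D.H x) s) := by
  have hH : HasFDerivAt (D.H x) (fderiv ℝ (D.H x) s) s :=
    ((D.contDiffAt_H_right hO hx hs).differentiableAt (by simp)).hasFDerivAt
  have hdom : {s | x + s ∈ O} ∈ nhds s :=
    (hO.preimage (continuous_const.add continuous_id)).mem_nhds hs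
  -- The image of `H x` is not yet known to be a neighbourhood, so `K x` is differentiated only
  -- within it; the composite `K x ∘ H x` still has a full derivative because its domain is open.
  have hK : DifferentiableWithinAt ℝ (D.K x) (D.H x '' {s | x + s ∈ O}) (D.H x s) := by
    have h1 : DifferentiableWithinAt ℝ (fun p : (Fin n → ℝ) × (Fin n → ℝ) => D.K p.1 p.2)
        {p | p.1 ∈ O ∧ ∃ s, p.1 + s ∈ O ∧ D.H p.1 s = p.2} (x, D.H x s) :=
      (D.smooth_K (x, D.H x s) ⟨hx, s, hs, rfl⟩).differentiableWithinAt (by simp)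
    refine h1.comp (D.H x s) (f := fun t => (x, t))
      ((differentiableAt_const x).prodMk differentiableAt_id).differentiableWithinAt ?_
    rintro _ ⟨r, hr, rfl⟩
    exact ⟨hx, r, hr, rfl⟩
  have hcomp := (hK.hasFDerivWithinAt.comp s hH.hasFDerivWithinAt
    (mapsTo_image (D.H x) {s | x + s ∈ O})).hasFDerivAt hdom
  have hid : HasFDerivAt (D.K x ∘ D.H x) (ContinuousLinearMap.id ℝ (Fin n → ℝ)) s := by
    refine (hasFDerivAt_id s).congr_of_eventuallyEq ?_
    filter_upwards [hdom] with r hr using D.K_H x hx r hr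
  have heq := hcomp.unique hid
  have hinj : Function.Injective (fderiv ℝ (D.H x) s) := by
    intro u v huv
    have hu := congrArg (fun L => L u) heq
    have hv := congrArg (fun L => L v) heq
    simp only [ContinuousLinearMap.comp_apply, ContinuousLinearMap.id_apply] at hu hv
    rw [← hu, ← hv, huv]
  exact ⟨hinj, (LinearMap.injective_iff_surjective
    (f := (fderiv ℝ (D.H x) s : (Fin n → ℝ) →ₗ[ℝ] (Fin n → ℝ)))).1 hinj⟩

theorem vielbein_comp_fderiv_H (D : Deformation O) (hO : IsOpen O) {x : Fin n → ℝ} (hx : x ∈ O) :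
    (D.vielbein x).comp (fderiv ℝ (D.H x) 0) = ContinuousLinearMap.id ℝ (Fin n → ℝ) := by
  have hx0 : x + 0 ∈ O := by simpa using hx
  have hstrict : HasStrictFDerivAt (D.H x) (fderiv ℝ (D.H x) 0) 0 :=
    (D.contDiffAt_H_right hO hx hx0).hasStrictFDerivAt (by simp)
  have hdom : {s | x + s ∈ O} ∈ nhds (0 : Fin n → ℝ) :=
    (hO.preimage (continuous_const.add continuous_id)).mem_nhds hx0
  -- By the surjective form of the inverse function theorem the values of `H x` fill a neighbourhood
  -- of `0`, so the `fderiv` in `vielbein` is a true derivative and not the default `0`.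
  have himage : D.H x '' {s | x + s ∈ O} ∈ nhds (0 : Fin n → ℝ) := by
    have hmap := hstrict.map_nhds_eq_of_surj
      (LinearMap.range_eq_top.2 (D.bijective_fderiv_H hO hx hx0).2)
    rw [D.H_zero x hx] at hmap
    rw [← hmap]
    exact Filter.image_mem_map hdom
  have hK : DifferentiableAt ℝ (D.K x) 0 := by
    have h1 : DifferentiableWithinAt ℝ (fun p : (Fin n → ℝ) × (Fin n → ℝ) => D.K p.1 p.2)
        {p | p.1 ∈ O ∧ ∃ s, p.1 + s ∈ O ∧ D.H p.1 s = p.2} (x, 0) :=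
      (D.smooth_K (x, 0) ⟨hx, 0, hx0, D.H_zero x hx⟩).differentiableWithinAt (by simp)
    refine DifferentiableWithinAt.differentiableAt (s := D.H x '' {s | x + s ∈ O}) ?_ himage
    refine h1.comp (0 : Fin n → ℝ) (f := fun t => (x, t))
      ((differentiableAt_const x).prodMk differentiableAt_id).differentiableWithinAt ?_
    rintro _ ⟨r, hr, rfl⟩
    exact ⟨hx, r, hr, rfl⟩
  have hKd : HasFDerivAt (D.K x) (D.vielbein x) (D.H x 0) := by
    rw [D.H_zero x hx]
    exact hK.hasFDerivAt
  refine (hKd.comp (0 : Fin n → ℝ) hstrict.hasFDerivAt).unique ?_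
  refine (hasFDerivAt_id (0 : Fin n → ℝ)).congr_of_eventuallyEq ?_
  filter_upwards [hdom] with r hr using D.K_H x hx r hr

theorem bijective_vielbein (D : Deformation O) (hO : IsOpen O) {x : Fin n → ℝ} (hx : x ∈ O) :
    Function.Bijective (D.vielbein x) := by
  have hsurj : Function.Surjective (D.vielbein x) := fun v =>
    ⟨fderiv ℝ (D.H x) 0 v, congrArg (fun L => L v) (D.vielbein_comp_fderiv_H hO hx)⟩
  exact ⟨(LinearMap.injective_iff_surjective
    (f := (D.vielbein x : (Fin n → ℝ) →ₗ[ℝ] (Fin n → ℝ)))).2 hsurj, hsurj⟩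

/-- Smoothness of the vielbein in `x` can thus be read off from `H` alone, through smoothness of
inversion. -/
theorem vielbein_eq_inverse (D : Deformation O) (hO : IsOpen O) {x : Fin n → ℝ} (hx : x ∈ O) :
    D.vielbein x = (fderiv ℝ (D.H x) 0).inverse := by
  have h := D.vielbein_comp_fderiv_H hO hx
  refine (ContinuousLinearMap.inverse_eq ?_ h).symm
  ext1 v
  obtain ⟨w, rfl⟩ := (D.bijective_fderiv_H hO hx (s := 0) (by simpa using hx)).2 v
  have hw := congrArg (fun L => L w) h
  simp only [ContinuousLinearMap.comp_apply, ContinuousLinearMap.id_apply] at hw ⊢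
  rw [hw]

theorem contDiffAt_vielbein (D : Deformation O) (hO : IsOpen O) {x : Fin n → ℝ} (hx : x ∈ O) :
    ContDiffAt ℝ ∞ D.vielbein x := by
  have hx0 : x + 0 ∈ O := by simpa using hx
  have h1 : ContDiffAt ℝ ∞ (fun z => fderiv ℝ (D.H z) 0) x :=
    ContDiffAt.fderiv (f := D.H) (g := fun _ => 0) (D.contDiffAt_H hO hx hx0) contDiffAt_const
      (by simp)
  have h2 : ContDiffAt ℝ ∞ (fun z => (fderiv ℝ (D.H z) 0).inverse) x :=
    ContDiffAt.comp (g := ContinuousLinearMap.inverse) x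
      (contDiffAt_inverse_of_bijective (D.bijective_fderiv_H hO hx hx0)) h1
  refine h2.congr_of_eventuallyEq ?_
  filter_upwards [hO.mem_nhds hx] with z hz using D.vielbein_eq_inverse hO hz

theorem contDiffAt_coordH (D : Deformation O) (hO : IsOpen O) {x s : Fin n → ℝ} (hx : x ∈ O)
    (hs : x + s ∈ O) : ContDiffAt ℝ ∞ (Function.uncurry D.coordH) (x, s) := by
  have h : ContDiffAt ℝ ∞ (fun p : (Fin n → ℝ) × (Fin n → ℝ) => D.vielbein p.1) (x, s) :=
    (D.contDiffAt_vielbein hO hx).comp (x, s) contDiffAt_fst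
  exact h.clm_apply (D.contDiffAt_H hO hx hs)

theorem contDiffAt_coordH_right (D : Deformation O) (hO : IsOpen O) {x s : Fin n → ℝ} (hx : x ∈ O)
    (hs : x + s ∈ O) : ContDiffAt ℝ ∞ (D.coordH x) s :=
  (D.contDiffAt_coordH hO hx hs).comp s (contDiffAt_const.prodMk contDiffAt_id)

theorem contDiffAt_fderiv_coordH (D : Deformation O) (hO : IsOpen O) {x s : Fin n → ℝ}
    (hx : x ∈ O) (hs : x + s ∈ O) :
    ContDiffAt ℝ ∞ (fun p : (Fin n → ℝ) × (Fin n → ℝ) => fderiv ℝ (D.coordH p.1) p.2) (x, s) := by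
  refine ContDiffAt.fderiv (f := fun p : (Fin n → ℝ) × (Fin n → ℝ) => D.coordH p.1)
    (g := Prod.snd) (n := ∞) ?_ contDiffAt_snd (by simp)
  exact (D.contDiffAt_coordH hO hx hs).comp ((x, s), s)
    ((contDiffAt_fst.comp _ contDiffAt_fst).prodMk contDiffAt_snd)

theorem contDiffAt_Gam (D : Deformation O) (hO : IsOpen O) {x : Fin n → ℝ} (hx : x ∈ O) :
    ContDiffAt ℝ ∞ D.Gam x :=
  ContDiffAt.fderiv (f := fun z => fderiv ℝ (D.coordH z)) (g := fun _ => 0) (n := ∞)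
    (D.contDiffAt_fderiv_coordH hO hx (by simpa using hx)) contDiffAt_const (by simp)

theorem contDiffAt_transport (D : Deformation O) (hO : IsOpen O) {x x' : Fin n → ℝ} (hx : x ∈ O)
    (hx' : x' ∈ O) :
    ContDiffAt ℝ ∞ (fun p : (Fin n → ℝ) × (Fin n → ℝ) => D.transport p.1 p.2) (x, x') :=
  (D.contDiffAt_fderiv_coordH hO hx (s := x' - x) (by simpa using hx')).comp (x, x')
    (contDiffAt_fst.prodMk (contDiffAt_snd.sub contDiffAt_fst))

theorem isTorsionFreeConnection_Gam (D : Deformation O) (hO : IsOpen O) :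
    IsTorsionFreeConnection O D.Gam where
  smooth := fun x hx => (D.contDiffAt_Gam hO hx).contDiffWithinAt
  symm := fun x hx u v => by
    have h := (D.contDiffAt_coordH_right hO hx (s := 0) (by simpa using hx)).isSymmSndFDerivAt
      (by simpa using WithTop.coe_le_coe.2 (le_top : (2 : ℕ∞) ≤ ⊤))
    exact h u v

theorem fderiv_coordH (D : Deformation O) (hO : IsOpen O) {x s : Fin n → ℝ} (hx : x ∈ O)
    (hs : x + s ∈ O) :
    fderiv ℝ (D.coordH x) s = (D.vielbein x).comp (fderiv ℝ (D.H x) s) :=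
  ((D.vielbein x).hasFDerivAt.comp s
    ((D.contDiffAt_H_right hO hx hs).differentiableAt (by simp)).hasFDerivAt).fderiv

theorem transport_self (D : Deformation O) (hO : IsOpen O) {x : Fin n → ℝ} (hx : x ∈ O) :
    D.transport x x = ContinuousLinearMap.id ℝ (Fin n → ℝ) := by
  rw [transport, sub_self, D.fderiv_coordH hO hx (by simpa using hx),
    D.vielbein_comp_fderiv_H hO hx]

theorem bijective_transport (D : Deformation O) (hO : IsOpen O) {x x' : Fin n → ℝ} (hx : x ∈ O)
    (hx' : x' ∈ O) : Function.Bijective (D.transport x x') := by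
  have hs : x + (x' - x) ∈ O := by simpa using hx'
  rw [transport, D.fderiv_coordH hO hx hs]
  exact (D.bijective_vielbein hO hx).comp (D.bijective_fderiv_H hO hx hs)

theorem coordH_injOn (D : Deformation O) (hO : IsOpen O) {x : Fin n → ℝ} (hx : x ∈ O) :
    InjOn (D.coordH x) {s | x + s ∈ O} := by
  intro s hs r hr h
  rw [← D.K_H x hx s hs, ← D.K_H x hx r hr, (D.bijective_vielbein hO hx).1 h]

theorem coordH_zero (D : Deformation O) {x : Fin n → ℝ} (hx : x ∈ O) : D.coordH x 0 = 0 := by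
  simp [coordH, D.H_zero x hx]

theorem hasFDerivAt_coordH_sub (D : Deformation O) (hO : IsOpen O) {x x' : Fin n → ℝ} (hx : x ∈ O)
    (hx' : x' ∈ O) : HasFDerivAt (fun z => D.coordH x (z - x)) (D.transport x x') x' :=
  (hasFDerivAt_comp_sub x).2 ((D.contDiffAt_coordH_right hO hx (s := x' - x)
    (by simpa using hx')).differentiableAt (by simp)).hasFDerivAt

/-- The second derivative of the deformation functions, as the derivative of the transport matrix
in the second point. -/
noncomputable def transportDeriv (D : Deformation O) (x x' : Fin n → ℝ) :
    (Fin n → ℝ) →L[ℝ] (Fin n → ℝ) →L[ℝ] (Fin n → ℝ) :=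
  fderiv ℝ (fderiv ℝ (D.coordH x)) (x' - x)

theorem transportDeriv_self (D : Deformation O) (x : Fin n → ℝ) :
    D.transportDeriv x x = D.Gam x := by
  rw [transportDeriv, sub_self, Gam]

theorem contDiffAt_transport_right (D : Deformation O) (hO : IsOpen O) {x x' : Fin n → ℝ}
    (hx : x ∈ O) (hx' : x' ∈ O) : ContDiffAt ℝ ∞ (D.transport x) x' :=
  (D.contDiffAt_transport hO hx hx').comp x' (contDiffAt_const.prodMk contDiffAt_id)

theorem hasFDerivAt_transport (D : Deformation O) (hO : IsOpen O) {x x' : Fin n → ℝ}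
    (hx : x ∈ O) (hx' : x' ∈ O) : HasFDerivAt (D.transport x) (D.transportDeriv x x') x' := by
  have h := ((D.contDiffAt_transport_right hO hx hx').differentiableAt (by simp)).hasFDerivAt
  have he : fderiv ℝ (D.transport x) x' = D.transportDeriv x x' :=
    fderiv_comp_sub (f := fderiv ℝ (D.coordH x)) x
  rwa [he] at h

theorem contDiffAt_transportDeriv (D : Deformation O) (hO : IsOpen O) {x x' : Fin n → ℝ}
    (hx : x ∈ O) (hx' : x' ∈ O) : ContDiffAt ℝ ∞ (D.transportDeriv x) x' := by
  have h := (D.contDiffAt_transport_right hO hx hx').fderiv_right (m := ∞) (by simp)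
  refine h.congr_of_eventuallyEq ?_
  filter_upwards [hO.mem_nhds hx'] with z hz using (D.hasFDerivAt_transport hO hx hz).fderiv.symm

end Deformation

/-! ### Calculus along curves, and reparameterization of geodesics. -/

theorem eq_of_hasDerivWithinAt_zero {E : Type*} [NormedAddCommGroup E] [NormedSpace ℝ E] {T : ℝ}
    {f : ℝ → E} (hf : ∀ s ∈ Icc 0 T, HasDerivWithinAt f 0 (Icc 0 T) s) {s : ℝ}
    (hs : s ∈ Icc 0 T) : f s = f 0 := by
  have h := (convex_Icc (0 : ℝ) T).norm_image_sub_le_of_norm_hasDerivWithin_le (C := 0)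
    (fun r hr => hf r hr) (by simp) (left_mem_Icc.2 (hs.1.trans hs.2)) hs
  simpa [sub_eq_zero] using h

namespace IsCurve

variable {n : ℕ} {O : Set (Fin n → ℝ)} {x x' : Fin n → ℝ} {T : ℝ} {y τ : ℝ → Fin n → ℝ}

theorem source_mem (h : IsCurve O x x' T y τ) : x ∈ O :=
  h.source ▸ h.mem 0 (left_mem_Icc.2 h.pos.le)

theorem hasDerivWithinAt_coordH (h : IsCurve O x x' T y τ) (D : Deformation O) (hO : IsOpen O)
    {z : Fin n → ℝ} (hz : z ∈ O) {s : ℝ} (hs : s ∈ Icc 0 T) :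
    HasDerivWithinAt (fun s' => D.coordH z (y s' - z)) (D.transport z (y s) (τ s)) (Icc 0 T) s :=
  (D.hasFDerivAt_coordH_sub hO hz (h.mem s hs)).comp_hasDerivWithinAt s (h.velocity s hs)

theorem hasDerivWithinAt_transport_apply (h : IsCurve O x x' T y τ) (D : Deformation O)
    (hO : IsOpen O) {z : Fin n → ℝ} (hz : z ∈ O) {s : ℝ} (hs : s ∈ Icc 0 T) {a : Fin n → ℝ}
    (ha : HasDerivWithinAt τ a (Icc 0 T) s) :
    HasDerivWithinAt (fun s' => D.transport z (y s') (τ s'))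
      (D.transportDeriv z (y s) (τ s) (τ s) + D.transport z (y s) a) (Icc 0 T) s :=
  ((D.hasFDerivAt_transport hO hz (h.mem s hs)).comp_hasDerivWithinAt s
    (h.velocity s hs)).clm_apply ha

theorem continuousOn (h : IsCurve O x x' T y τ) : ContinuousOn y (Icc 0 T) :=
  fun s hs => (h.velocity s hs).continuousWithinAt

/-- The derivative of `coordH x (y s - x)` is `v` and its initial value is `0`, so the curve is a
straight line in normal coordinates. -/
theorem coordH_eq_smul (h : IsCurve O x x' T y τ) (D : Deformation O) (hO : IsOpen O)
    {v : Fin n → ℝ} (hv : ∀ s ∈ Icc 0 T, D.transport x (y s) (τ s) = v) {s : ℝ}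
    (hs : s ∈ Icc 0 T) : D.coordH x (y s - x) = s • v := by
  have hd : ∀ r ∈ Icc 0 T,
      HasDerivWithinAt (fun r => D.coordH x (y r - x) - r • v) 0 (Icc 0 T) r := by
    intro r hr
    have h1 := (h.hasDerivWithinAt_coordH D hO h.source_mem hr).sub
      ((hasDerivWithinAt_id r (Icc 0 T)).smul_const v)
    rw [hv r hr, one_smul, sub_self] at h1
    exact h1
  have h0 := eq_of_hasDerivWithinAt_zero hd hs
  simp only [h.source, sub_self, D.coordH_zero h.source_mem, zero_smul] at h0
  exact sub_eq_zero.1 h0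

end IsCurve

namespace IsGeodesic

variable {n : ℕ} {O : Set (Fin n → ℝ)}
  {Γ : (Fin n → ℝ) → (Fin n → ℝ) →L[ℝ] (Fin n → ℝ) →L[ℝ] (Fin n → ℝ)}
  {x x' : Fin n → ℝ} {T : ℝ} {y τ : ℝ → Fin n → ℝ}

theorem congr (h : IsGeodesic O Γ x x' T y τ)
    {Γ' : (Fin n → ℝ) → (Fin n → ℝ) →L[ℝ] (Fin n → ℝ) →L[ℝ] (Fin n → ℝ)}
    (hΓ : ∀ z ∈ O, Γ z = Γ' z) : IsGeodesic O Γ' x x' T y τ where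
  toIsCurve := h.toIsCurve
  geodesic := fun s hs => by
    rw [← hΓ _ (h.mem s hs)]
    exact h.geodesic s hs

theorem reverse (h : IsGeodesic O Γ x x' T y τ) :
    IsGeodesic O Γ x' x T (fun s => y (T - s)) (fun s => -τ (T - s)) := by
  have hmaps : MapsTo (fun s => T - s) (Icc 0 T) (Icc 0 T) := fun s hs =>
    ⟨sub_nonneg.2 hs.2, sub_le_self _ hs.1⟩
  have hsub : ∀ s, HasDerivWithinAt (fun s : ℝ => T - s) (-1) (Icc 0 T) s := fun s =>
    (hasDerivWithinAt_id s (Icc 0 T)).const_sub T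
  refine ⟨⟨h.pos, fun s hs => h.mem _ (hmaps hs), by simpa using h.target,
    by simpa using h.source, fun s hs => ?_⟩, fun s hs => ?_⟩
  · exact ((h.velocity _ (hmaps hs)).scomp s (hsub s) hmaps).congr_deriv (by simp)
  · exact ((h.geodesic _ (hmaps hs)).scomp s (hsub s) hmaps).neg.congr_deriv (by simp)

theorem tail (h : IsGeodesic O Γ x x' T y τ) {a : ℝ} (ha : a ∈ Ico 0 T) :
    IsGeodesic O Γ (y a) x' (T - a) (fun s => y (a + s)) (fun s => τ (a + s)) := by
  have hmaps : MapsTo (fun s => a + s) (Icc 0 (T - a)) (Icc 0 T) := fun s hs =>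
    ⟨add_nonneg ha.1 hs.1, by linarith [hs.2]⟩
  have hadd : ∀ s, HasDerivWithinAt (fun s : ℝ => a + s) 1 (Icc 0 (T - a)) s := fun s =>
    (hasDerivWithinAt_id s _).const_add a
  refine ⟨⟨sub_pos.2 ha.2, fun s hs => h.mem _ (hmaps hs), by simp,
    by simpa using h.target, fun s hs => ?_⟩, fun s hs => ?_⟩
  · exact ((h.velocity _ (hmaps hs)).scomp s (hadd s) hmaps).congr_deriv (by simp)
  · exact ((h.geodesic _ (hmaps hs)).scomp s (hadd s) hmaps).congr_deriv (by simp)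

end IsGeodesic

/-! ### Canonical curves: geodesic equation and uniqueness. -/

namespace Deformation

variable {n : ℕ} {O : Set (Fin n → ℝ)} {x x' : Fin n → ℝ}

namespace CanonicalAlong

variable {D : Deformation O} {T : ℝ} {y τ : ℝ → Fin n → ℝ}

theorem transport_eq (h : D.CanonicalAlong x x' T y τ) {s : ℝ} (hs : s ∈ Icc 0 T) :
    D.transport x (y s) (τ s) = τ 0 := by
  rw [h.canonical 0 (left_mem_Icc.2 h.pos.le) s hs, h.source]

theorem coordH_eq (h : D.CanonicalAlong x x' T y τ) (hO : IsOpen O) {s : ℝ} (hs : s ∈ Icc 0 T) :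
    D.coordH x (y s - x) = s • τ 0 :=
  h.coordH_eq_smul D hO (fun _ hr => h.transport_eq hr) hs

theorem isGeodesic (h : D.CanonicalAlong x x' T y τ) (hO : IsOpen O) :
    IsGeodesic O D.Gam x x' T y τ where
  toIsCurve := h.toIsCurve
  geodesic := fun s hs => by
    have h0 : (0 : ℝ) ∈ Icc 0 T := left_mem_Icc.2 h.pos.le
    -- No regularity of `τ` is assumed; canonicity against the fixed parameter `0` writes `τ` as a
    -- smooth matrix along `y` applied to `τ 0`.
    have hdiff : DifferentiableWithinAt ℝ τ (Icc 0 T) s := by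
      have hA : DifferentiableAt ℝ (fun z => D.transport z (y 0)) (y s) :=
        ((D.contDiffAt_transport hO (h.mem s hs) (h.mem 0 h0)).comp (y s)
          (contDiffAt_id.prodMk contDiffAt_const)).differentiableAt (by simp)
      have hA' := hA.comp_differentiableWithinAt s (h.velocity s hs).differentiableWithinAt
      exact (hA'.clm_apply (differentiableWithinAt_const (τ 0))).congr
        (fun r hr => h.canonical r hr 0 h0) (h.canonical s hs 0 h0)
    obtain ⟨a, ha⟩ : ∃ a, HasDerivWithinAt τ a (Icc 0 T) s := ⟨_, hdiff.hasDerivWithinAt⟩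
    have h1 := h.hasDerivWithinAt_transport_apply D hO (h.mem s hs) hs ha
    have h2 : HasDerivWithinAt (fun s' => D.transport (y s) (y s') (τ s')) 0 (Icc 0 T) s :=
      (hasDerivWithinAt_const s (Icc 0 T) (τ s)).congr
        (fun r hr => (h.canonical s hs r hr).symm) (h.canonical s hs s hs).symm
    have h3 := (uniqueDiffOn_Icc h.pos s hs).eq_deriv _ h1 h2
    rw [transportDeriv_self, D.transport_self hO (h.mem s hs), ContinuousLinearMap.id_apply] at h3
    rwa [← eq_neg_of_add_eq_zero_right h3]

theorem smul_eq_coordH (h : D.CanonicalAlong x x' T y τ) (hO : IsOpen O) :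
    T • τ 0 = D.coordH x (x' - x) := by
  rw [← h.coordH_eq hO (right_mem_Icc.2 h.pos.le), h.target]

/-- In normal coordinates both curves are the segment `r • coordH x (x' - x)`, and these coordinates
are injective. -/
theorem unique {T₁ T₂ : ℝ} {y₁ τ₁ y₂ τ₂ : ℝ → Fin n → ℝ}
    (h₁ : D.CanonicalAlong x x' T₁ y₁ τ₁) (h₂ : D.CanonicalAlong x x' T₂ y₂ τ₂) (hO : IsOpen O)
    {r : ℝ} (hr : r ∈ Icc (0 : ℝ) 1) : y₁ (T₁ * r) = y₂ (T₂ * r) := by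
  have key : ∀ {T : ℝ} {y τ : ℝ → Fin n → ℝ}, D.CanonicalAlong x x' T y τ →
      x + (y (T * r) - x) ∈ O ∧ D.coordH x (y (T * r) - x) = r • D.coordH x (x' - x) := by
    intro T y τ h
    have hs : T * r ∈ Icc 0 T :=
      ⟨mul_nonneg h.pos.le hr.1, mul_le_of_le_one_right h.pos.le hr.2⟩
    refine ⟨by simpa using h.mem _ hs, ?_⟩
    rw [h.coordH_eq hO hs, ← h.smul_eq_coordH hO, smul_smul, mul_comm]
  have h := D.coordH_injOn hO h₁.source_mem (key h₁).1 (key h₂).1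
    ((key h₁).2.trans (key h₂).2.symm)
  exact sub_left_injective h

end CanonicalAlong

/-! ### Geodesics of a canonical deformation are canonical. -/

/-- The difference, transported to `x`, between the second derivative of the deformation functions
and the connection: the deformation functions map a geodesic to a curve whose acceleration is the
value of this form on the velocity. -/
noncomputable def defect (D : Deformation O) (x z : Fin n → ℝ) :
    (Fin n → ℝ) →L[ℝ] (Fin n → ℝ) →L[ℝ] (Fin n → ℝ) :=
  D.transportDeriv x z -
    (ContinuousLinearMap.compL ℝ (Fin n → ℝ) (Fin n → ℝ) (Fin n → ℝ) (D.transport x z)).comp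
      (D.Gam z)

theorem defect_apply (D : Deformation O) (x z u v : Fin n → ℝ) :
    D.defect x z u v = D.transportDeriv x z u v - D.transport x z (D.Gam z u v) := rfl

theorem defect_self (D : Deformation O) (hO : IsOpen O) (hx : x ∈ O) (u v : Fin n → ℝ) :
    D.defect x x u v = 0 := by
  rw [defect_apply, transportDeriv_self, D.transport_self hO hx, ContinuousLinearMap.id_apply,
    sub_self]

theorem contDiffAt_defect (D : Deformation O) (hO : IsOpen O) {z : Fin n → ℝ} (hx : x ∈ O)
    (hz : z ∈ O) : ContDiffAt ℝ ∞ (D.defect x) z :=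
  (D.contDiffAt_transportDeriv hO hx hz).sub
    (((ContinuousLinearMap.contDiff _).contDiffAt.comp z
      (D.contDiffAt_transport_right hO hx hz)).clm_comp (D.contDiffAt_Gam hO hz))

theorem _root_.IsGeodesic.hasDerivWithinAt_transport (D : Deformation O) (hO : IsOpen O) {T : ℝ}
    {y τ : ℝ → Fin n → ℝ} {z : Fin n → ℝ} (h : IsGeodesic O D.Gam x x' T y τ) (hz : z ∈ O) {s : ℝ}
    (hs : s ∈ Icc 0 T) :
    HasDerivWithinAt (fun s' => D.transport z (y s') (τ s')) (D.defect z (y s) (τ s) (τ s))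
      (Icc 0 T) s := by
  have h1 := h.hasDerivWithinAt_transport_apply D hO hz hs (h.geodesic s hs)
  rwa [map_neg, ← sub_eq_add_neg, ← defect_apply] at h1

/-- Along a canonical curve from `x` to `z` the transported velocity is constant, so `defect`
vanishes on its final velocity; `w` is that velocity times `T`. -/
theorem IsCanonical.defect_radial {D : Deformation O} (hD : D.IsCanonical) (hO : IsOpen O)
    {z w : Fin n → ℝ} (hx : x ∈ O) (hz : z ∈ O) (hw : D.transport x z w = D.coordH x (z - x)) :
    D.defect x z w w = 0 := by
  obtain ⟨T, y, τ, h⟩ := hD x hx z hz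
  have hT : T ∈ Icc 0 T := right_mem_Icc.2 h.pos.le
  have h1 := IsGeodesic.hasDerivWithinAt_transport D hO (h.isGeodesic hO) hx hT
  have h2 : HasDerivWithinAt (fun s' => D.transport x (y s') (τ s')) 0 (Icc 0 T) T :=
    (hasDerivWithinAt_const T (Icc 0 T) (τ 0)).congr
      (fun r hr => h.transport_eq hr) (h.transport_eq hT)
  have h3 := (uniqueDiffOn_Icc h.pos T hT).eq_deriv _ h1 h2
  rw [h.target] at h3
  have hw' : w = T • τ T := by
    refine (D.bijective_transport hO hx hz).1 ?_
    rw [hw, map_smul, ← h.smul_eq_coordH hO, ← h.transport_eq hT, h.target]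
  rw [hw']
  simp [h3]

theorem IsCanonical.transport_geodesic_source {D : Deformation O} (hD : D.IsCanonical)
    (hO : IsOpen O) {T : ℝ} {y τ : ℝ → Fin n → ℝ} (h : IsGeodesic O D.Gam x x' T y τ) {s : ℝ}
    (hs : s ∈ Icc 0 T) : D.transport x (y s) (τ s) = τ 0 := by
  have hx := h.source_mem
  have h0 : (0 : ℝ) ∈ Icc 0 T := left_mem_Icc.2 h.pos.le
  set u : ℝ → Fin n → ℝ := fun s => D.coordH x (y s - x) with hu
  set p : ℝ → Fin n → ℝ := fun s => D.transport x (y s) (τ s) with hp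
  set w : ℝ → Fin n → ℝ := fun s => u s - s • p s with hw
  -- `W s + s • τ s` is the preimage of `u s` under transport, hence radial at `y s`.
  set W : ℝ → Fin n → ℝ := fun s => (D.transport x (y s)).inverse (w s) with hW
  have hu' : ∀ s ∈ Icc 0 T, HasDerivWithinAt u (p s) (Icc 0 T) s := fun s hs =>
    h.hasDerivWithinAt_coordH D hO hx hs
  have hp' : ∀ s ∈ Icc 0 T, HasDerivWithinAt p (D.defect x (y s) (τ s) (τ s)) (Icc 0 T) s :=
    fun s hs => h.hasDerivWithinAt_transport D hO hx hs
  have hw' : ∀ s ∈ Icc 0 T,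
      HasDerivWithinAt w (-(s • D.defect x (y s) (τ s) (τ s))) (Icc 0 T) s := by
    intro s hs
    have h1 := (hu' s hs).sub ((hasDerivWithinAt_id s (Icc 0 T)).smul (hp' s hs))
    refine h1.congr_deriv ?_
    simp
  have hquad : ∀ s ∈ Icc 0 T, D.defect x (y s) (W s + s • τ s) (W s + s • τ s) = 0 := by
    intro s hs
    refine hD.defect_radial hO hx (h.mem s hs) ?_
    rw [map_add, map_smul, hW, apply_inverse_of_bijective (D.bijective_transport hO hx (h.mem s hs))]
    exact sub_add_cancel _ _
  have hu0 : u 0 = 0 := by simp [hu, h.source, D.coordH_zero hx]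
  obtain ⟨P, hP⟩ := isCompact_Icc.exists_bound_of_continuousOn
    (fun s hs => (hp' s hs).continuousWithinAt : ContinuousOn p (Icc 0 T))
  obtain ⟨V, hV⟩ := isCompact_Icc.exists_bound_of_continuousOn
    (fun s hs => (h.geodesic s hs).continuousWithinAt : ContinuousOn τ (Icc 0 T))
  have hBc : ContinuousOn (fun s => D.defect x (y s)) (Icc 0 T) := fun s hs =>
    (D.contDiffAt_defect hO hx (h.mem s hs)).continuousAt.comp_continuousWithinAt
      (h.continuousOn s hs)
  have hAc : ContinuousOn (fun s => (D.transport x (y s)).inverse) (Icc 0 T) := fun s hs =>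
    ((contDiffAt_inverse_of_bijective
      (D.bijective_transport hO hx (h.mem s hs))).continuousAt.comp
        (D.contDiffAt_transport_right hO hx (h.mem s hs)).continuousAt).comp_continuousWithinAt
      (h.continuousOn s hs)
  obtain ⟨b, hb⟩ := isCompact_Icc.exists_bound_of_continuousOn
    (E := (Fin n → ℝ) →L[ℝ] (Fin n → ℝ) →L[ℝ] (Fin n → ℝ)) hBc
  obtain ⟨c, hc⟩ := isCompact_Icc.exists_bound_of_continuousOn hAc
  have hP0 := (norm_nonneg _).trans (hP 0 h0)
  have hV0 := (norm_nonneg _).trans (hV 0 h0)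
  have hb0 := (norm_nonneg _).trans (hb 0 h0)
  have hc0 := (norm_nonneg _).trans (hc 0 h0)
  -- This bound pays for the division by `s` below: one factor `‖w s‖` in the quadratic term is
  -- traded for a multiple of `s`.
  have hwle : ∀ s ∈ Icc 0 T, ‖w s‖ ≤ 2 * P * s := by
    intro s hs
    have h1 : ‖u s‖ ≤ P * s := by
      have := (convex_Icc (0 : ℝ) T).norm_image_sub_le_of_norm_hasDerivWithin_le hu' hP h0 hs
      simpa [hu0, abs_of_nonneg hs.1] using this
    have h2 : ‖s • p s‖ ≤ P * s := by
      rw [norm_smul, Real.norm_of_nonneg hs.1, mul_comm]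
      exact mul_le_mul_of_nonneg_right (hP s hs) hs.1
    calc ‖w s‖ ≤ ‖u s‖ + ‖s • p s‖ := norm_sub_le _ _
      _ ≤ 2 * P * s := by linarith
  have hWle : ∀ s ∈ Icc 0 T, ‖W s‖ ≤ c * ‖w s‖ := fun s hs =>
    ((D.transport x (y s)).inverse.le_opNorm _).trans
      (mul_le_mul_of_nonneg_right (hc s hs) (norm_nonneg _))
  have hBle : ∀ s ∈ Icc 0 T, ∀ v v', ‖D.defect x (y s) v v'‖ ≤ b * ‖v‖ * ‖v'‖ := fun s hs v v' =>
    ((D.defect x (y s)).le_opNorm₂ v v').trans (by gcongr; exact hb s hs)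
  have hbound : ∀ s ∈ Icc 0 T, ‖-(s • D.defect x (y s) (τ s) (τ s))‖ ≤
      (b * c * c * (2 * P) + 2 * (b * c * V)) * ‖w s‖ + 0 := by
    intro s hs
    rcases hs.1.eq_or_lt with rfl | hpos
    · simp only [zero_smul, neg_zero, norm_zero]
      positivity
    have hq := hquad s hs
    simp only [map_add, map_smul, add_apply, smul_apply]
      at hq
    -- Expansion of the quadratic form `hquad`, solved for its `s ^ 2` term.
    have heq : s • -(s • D.defect x (y s) (τ s) (τ s)) = D.defect x (y s) (W s) (W s) +
        s • (D.defect x (y s) (W s) (τ s) + D.defect x (y s) (τ s) (W s)) := by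
      rw [← sub_eq_zero, ← neg_eq_zero, ← hq]
      module
    have hW1 := hWle s hs
    have h1 : ‖D.defect x (y s) (W s) (W s)‖ ≤ s * (b * c * c * (2 * P) * ‖w s‖) :=
      calc _ ≤ b * ‖W s‖ * ‖W s‖ := hBle s hs _ _
        _ ≤ b * (c * ‖w s‖) * (c * (2 * P * s)) := by
          gcongr
          exact hW1.trans (mul_le_mul_of_nonneg_left (hwle s hs) hc0)
        _ = _ := by ring
    have h2 : ‖D.defect x (y s) (W s) (τ s)‖ ≤ b * c * V * ‖w s‖ :=
      calc _ ≤ b * ‖W s‖ * ‖τ s‖ := hBle s hs _ _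
        _ ≤ b * (c * ‖w s‖) * V := by gcongr; exact hV s hs
        _ = _ := by ring
    have h3 : ‖D.defect x (y s) (τ s) (W s)‖ ≤ b * c * V * ‖w s‖ :=
      calc _ ≤ b * ‖τ s‖ * ‖W s‖ := hBle s hs _ _
        _ ≤ b * V * (c * ‖w s‖) := by gcongr; exact hV s hs
        _ = _ := by ring
    refine le_of_mul_le_mul_left ?_ hpos
    calc s * ‖-(s • D.defect x (y s) (τ s) (τ s))‖
        = ‖s • -(s • D.defect x (y s) (τ s) (τ s))‖ := by
          rw [norm_smul, Real.norm_of_nonneg hs.1]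
      _ ≤ ‖D.defect x (y s) (W s) (W s)‖ +
          s * ‖D.defect x (y s) (W s) (τ s) + D.defect x (y s) (τ s) (W s)‖ := by
          rw [heq]
          refine (norm_add_le _ _).trans ?_
          rw [norm_smul, Real.norm_of_nonneg hs.1]
      _ ≤ s * (b * c * c * (2 * P) * ‖w s‖) + s * (b * c * V * ‖w s‖ + b * c * V * ‖w s‖) := by
          gcongr
          exact (norm_add_le _ _).trans (add_le_add h2 h3)
      _ = _ := by ring
  have hw0 : ∀ s ∈ Icc 0 T, w s = 0 := by
    intro s hs
    have h1 := norm_le_gronwallBound_of_norm_deriv_right_le (δ := 0)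
      (fun r hr => (hw' r hr).continuousWithinAt)
      (fun r hr => (hw' r (Ico_subset_Icc_self hr)).mono_of_mem_nhdsWithin
        (Filter.mem_of_superset (Icc_mem_nhdsGE hr.2) (Icc_subset_Icc_left hr.1)))
      (by simp [hw, hu0]) (fun r hr => hbound r (Ico_subset_Icc_self hr)) s hs
    rwa [gronwallBound_ε0_δ0, norm_le_zero_iff] at h1
  have hdef : ∀ s ∈ Icc 0 T, D.defect x (y s) (τ s) (τ s) = 0 := by
    intro s hs
    rcases hs.1.eq_or_lt with rfl | hpos
    -- At `s = 0` the radial identity is void, but `defect` vanishes on the diagonal.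
    · rw [h.source, D.defect_self hO hx]
    have hW0 : W s = 0 := by simp [hW, hw0 s hs]
    simpa [hW0, hpos.ne'] using hquad s hs
  have hconst := eq_of_hasDerivWithinAt_zero (fun r hr => hdef r hr ▸ hp' r hr) hs
  simpa [hp, h.source, D.transport_self hO hx] using hconst

/-- Restarting the geodesic at `s₀` reduces to the source case; for `s < s₀` it is reversed first,
and the two signs cancel. -/
theorem IsCanonical.transport_geodesic {D : Deformation O} (hD : D.IsCanonical) (hO : IsOpen O)
    {T : ℝ} {y τ : ℝ → Fin n → ℝ} (h : IsGeodesic O D.Gam x x' T y τ) {s₀ s : ℝ}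
    (hs₀ : s₀ ∈ Icc 0 T) (hs : s ∈ Icc 0 T) : D.transport (y s₀) (y s) (τ s) = τ s₀ := by
  have key : ∀ {x x' : Fin n → ℝ} {y τ : ℝ → Fin n → ℝ}, IsGeodesic O D.Gam x x' T y τ →
      ∀ {a b : ℝ}, 0 ≤ a → a < b → b ≤ T → D.transport (y a) (y b) (τ b) = τ a := by
    intro x x' y τ h a b ha hab hb
    have h1 := hD.transport_geodesic_source hO (h.tail ⟨ha, hab.trans_le hb⟩) (s := b - a)
      ⟨sub_nonneg.2 hab.le, sub_le_sub_right hb a⟩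
    simpa using h1
  rcases lt_trichotomy s₀ s with hlt | rfl | hlt
  · exact key h hs₀.1 hlt hs.2
  · rw [D.transport_self hO (h.mem _ hs), ContinuousLinearMap.id_apply]
  · have h1 := key h.reverse (sub_nonneg.2 hs₀.2) (sub_lt_sub_left hlt T) (sub_le_self T hs.1)
    simpa using h1

theorem IsCanonical.canonicalAlong {D : Deformation O} (hD : D.IsCanonical) (hO : IsOpen O)
    {T : ℝ} {y τ : ℝ → Fin n → ℝ} (h : IsGeodesic O D.Gam x x' T y τ) :
    D.CanonicalAlong x x' T y τ where
  toIsCurve := h.toIsCurve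
  canonical := fun _ hs _ hs' => (hD.transport_geodesic hO h hs hs').symm

end Deformation

theorem proposition1 {n : ℕ} (O : Set (Fin n → ℝ)) (hO : IsOpen O) :
    -- (a)
    (∀ D : Deformation O,
      IsTorsionFreeConnection O D.Gam ∧
      -- a curve along which the condition of canonicity holds is a geodesic
      (∀ x x' T y τ, D.CanonicalAlong x x' T y τ → IsGeodesic O D.Gam x x' T y τ) ∧
      -- and is determined by its end points, up to the choice of the length `T` of the interval
      (∀ x x' T₁ y₁ τ₁ T₂ y₂ τ₂,
        D.CanonicalAlong x x' T₁ y₁ τ₁ → D.CanonicalAlong x x' T₂ y₂ τ₂ →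
          ∀ r ∈ Icc (0 : ℝ) 1, y₁ (T₁ * r) = y₂ (T₂ * r)) ∧
      -- if the deformation is canonical, it is even the only geodesic in `O` with these end points
      (D.IsCanonical → ∀ x x' T₁ y₁ τ₁ T₂ y₂ τ₂,
        D.CanonicalAlong x x' T₁ y₁ τ₁ → IsGeodesic O D.Gam x x' T₂ y₂ τ₂ →
          ∀ r ∈ Icc (0 : ℝ) 1, y₁ (T₁ * r) = y₂ (T₂ * r))) ∧
    -- (b)
    (∀ D₁ D₂ : Deformation O, D₁.IsCanonical → D₂.IsCanonical →
      (∀ x ∈ O, D₁.Gam x = D₂.Gam x) →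
        ∀ x ∈ O, ∀ s, x + s ∈ O → D₁.coordH x s = D₂.coordH x s) ∧
    (∀ D : Deformation O, D.IsCanonical →
      -- the derivatives of `H^μ(p, · - p)` along a geodesic through `p` are constant, equal to the
      -- velocity at `p`
      (∀ x x' T y τ, IsGeodesic O D.Gam x x' T y τ →
        ∀ s₀ ∈ Icc 0 T, ∀ s ∈ Icc 0 T,
          HasDerivWithinAt (fun s' => D.coordH (y s₀) (y s' - y s₀))
            (D.transport (y s₀) (y s) (τ s)) (Icc 0 T) s ∧
          D.transport (y s₀) (y s) (τ s) = τ s₀) ∧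
      -- and these first integrals are independent
      (∀ x ∈ O, ∀ x' ∈ O, Function.Bijective (D.transport x x'))) := by
  refine ⟨fun D => ⟨D.isTorsionFreeConnection_Gam hO, fun x x' T y τ h => h.isGeodesic hO,
    fun x x' T₁ y₁ τ₁ T₂ y₂ τ₂ h₁ h₂ r hr => h₁.unique h₂ hO hr,
    fun hD x x' T₁ y₁ τ₁ T₂ y₂ τ₂ h₁ h₂ r hr => h₁.unique (hD.canonicalAlong hO h₂) hO hr⟩, ?_, ?_⟩
  · intro D₁ D₂ hD₁ hD₂ hΓ x hx s hs
    obtain ⟨T, y, τ, h₁⟩ := hD₁ x hx (x + s) hs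
    -- The same curve, with the same `T` and `τ 0`, is canonical for both deformations.
    have h₂ := hD₂.canonicalAlong hO ((h₁.isGeodesic hO).congr hΓ)
    simpa using (h₁.smul_eq_coordH hO).symm.trans (h₂.smul_eq_coordH hO)
  · intro D hD
    exact ⟨fun x x' T y τ h s₀ hs₀ s hs => ⟨h.hasDerivWithinAt_coordH D hO (h.mem s₀ hs₀) hs,
      hD.transport_geodesic hO h hs₀ hs⟩, fun x hx x' hx' => D.bijective_transport hO hx hx'⟩
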